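/- **Asymptotic connectedness of random square-tiled surfaces.** For $n\ge 1$ and permutations $\sigma,\tau\in S_n$ let $S(\sigma,\tau)$ be the (labelled) square-tiled surface obtained from $n$ closed unit squares labelled $1,\dots,n$ by gluing, by translations, the right side of square $i$ to the left side of square $\sigma(i)$ and the top side of square $i$ to the bottom side of square $\tau(i)$, for every $i$. For a partition $\mu$ of $n$ let $\mathcal K_\mu\subseteq S_n$ be the conjugacy class of the permutations whose cycle lengths (fixed points included, as cycles of length $1$) are the parts of $\mu$. The probability of obtaining a connected surface is asymptotically $1$ in both of the following models. More precisely: 1. (Standard model.) If $(\sigma,\tau)$ is uniformly random in $S_n\times S_n$, then $$\Pr\big(S(\sigma,\tau)\text{ is connected}\big)=1-\frac1n+O\!\left(\frac1{n^2}\right)\qquad\text{as }n\to\infty;$$ in particular this probability tends to $1$. 2. (Horizontally restricted (HR) model.) Fix $\alpha\in[0,1)$. There are constants $C>0$ and $N\in\mathbb N$, depending only on $\alpha$, such that for every $n\ge N$ and every partition $\mu$ of $n$ with at most $n^\alpha$ parts, if $(\sigma,\tau)$ is uniformly random in $\mathcal K_{\mu}\times S_n$, then $$\Pr\big(S(\sigma,\tau)\text{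 is connected}\big)>1-\frac1{n^{1-\alpha}}-\frac{C}{n^{2-\alpha}}.$$ In particular, for every sequence of partitions $\mu_n\vdash n$ such that $\mu_n$ has at most $n^\alpha$ parts for all sufficiently large $n$, the probability that $S(\sigma,\tau)$ is connected for $(\sigma,\tau)$ uniform in $\mathcal K_{\mu_n}\times S_n$ tends to $1$ as $n\to\infty$. -/

import Mathlib

open Filter Topology Asymptotics

/-- One step of the gluing of the closed unit squares `{i} × [0,1] × [0,1]`, `i : Fin n`: the right
side of square `i` is glued by a translation to the left side of square `σ i`, and the top side of
square `i` is glued by a translation to the bottom side of square `τ i`. -/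
inductive SquareGluing {n : ℕ} (σ τ : Equiv.Perm (Fin n)) :
    Fin n × unitInterval × unitInterval → Fin n × unitInterval × unitInterval → Prop
  | horizontal (i : Fin n) (y : unitInterval) : SquareGluing σ τ (i, 1, y) (σ i, 0, y)
  | vertical (i : Fin n) (x : unitInterval) : SquareGluing σ τ (i, x, 1) (τ i, x, 0)

/-- The (topological space underlying the) labelled square-tiled surface `S(σ, τ)`: the quotient of
the disjoint union of `n` closed unit squares by the equivalence relation generated by the gluings
of their sides. -/
def SquareTiledSurface {n : ℕ} (σ τ : Equiv.Perm (Fin n)) : Type :=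
  Quot (SquareGluing σ τ)

/-- The quotient topology. -/
instance SquareTiledSurface.instTopologicalSpace {n : ℕ} (σ τ : Equiv.Perm (Fin n)) :
    TopologicalSpace (SquareTiledSurface σ τ) :=
  inferInstanceAs (TopologicalSpace (Quot (SquareGluing σ τ)))

/-- The probability of the event `E` for a uniformly random element of the set `X`. -/
noncomputable def uniformProb {Ω : Type} (X E : Set Ω) : ℝ :=
  letI : MeasurableSpace Ω := ⊤
  (ProbabilityTheory.uniformOn X).real E

/-- For a finite set, `uniformProb` is the proportion of favourable outcomes. -/
theorem uniformProb_eq {Ω : Type} [Finite Ω] (X E : Set Ω) :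
    uniformProb X E = ((X ∩ E).ncard : ℝ) / (X.ncard : ℝ) := by
  let _ : MeasurableSpace Ω := ⊤
  have hX : X.Finite := X.toFinite
  have hXE : (X ∩ E).Finite := (X ∩ E).toFinite
  change ((ProbabilityTheory.uniformOn X) E).toReal = _
  rw [ProbabilityTheory.uniformOn, ProbabilityTheory.cond_apply (MeasurableSpace.measurableSet_top),
    MeasureTheory.Measure.count_apply_finite _ hX, MeasureTheory.Measure.count_apply_finite _ hXE,
    ENNReal.toReal_mul, ENNReal.toReal_inv, Set.ncard_eq_toFinset_card X hX,
    Set.ncard_eq_toFinset_card (X ∩ E) hXE]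
  simp only [ENNReal.toReal_natCast]
  rw [div_eq_inv_mul]

/-- The conjugacy class of `S_n` indexed by the partition `μ` of `n`: the permutations whose cycle
lengths, fixed points included as cycles of length one, are the parts of `μ`. -/
def cycleTypeClass {n : ℕ} (μ : n.Partition) : Set (Equiv.Perm (Fin n)) :=
  {σ | σ.partition.parts = μ.parts}

/-- The set of pairs `(σ, τ)` for which the surface `S(σ, τ)` is connected. -/
def connectedPairs (n : ℕ) : Set (Equiv.Perm (Fin n) × Equiv.Perm (Fin n)) :=
  {p | ConnectedSpace (SquareTiledSurface p.1 p.2)}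

/-- The probability that `S(σ, τ)` is connected in the standard model, in which `(σ, τ)` is uniform
in `S_n × S_n`. -/
noncomputable def standardConnectedProb (n : ℕ) : ℝ :=
  uniformProb Set.univ (connectedPairs n)

/-- The probability that `S(σ, τ)` is connected in the horizontally restricted model, in which
`(σ, τ)` is uniform in `K_μ × S_n`, with `K_μ` the conjugacy class of the partition `μ`. -/
noncomputable def hrConnectedProb {n : ℕ} (μ : n.Partition) : ℝ :=
  uniformProb (cycleTypeClass μ ×ˢ Set.univ) (connectedPairs n)

/-!
A clopen subset of `S(σ, τ)` is a union of images of squares, so for `n ≥ 1` the surface is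
disconnected exactly when some nonempty proper set `A` of labels is invariant under both `σ` and
`τ`; passing to the complement, `2 * |A| ≤ n` may be assumed. A given `A` is invariant under a
uniform permutation with probability `1 / n.choose |A|` (`card_isInv_eq_div_choose`).

In the standard model the union bound over `A` gives `∑ 1 / n.choose k` over `1 ≤ k ≤ n / 2`, which
is `1 / n + O(1 / n ^ 2)` (`card_compl_connectedPairs_le`). The matching lower bound is a
second-order Bonferroni inequality for the common fixed points of `σ` and `τ`
(`le_card_compl_connectedPairs`).

In the restricted model a bound is proved for each fixed `σ` with `m` cycles and uniform `τ`
(`card_not_connectedSpace_le`). The plain union bound is too weak: pairs of fixed points of `σ`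
alone would contribute an error of order `m ^ 2 / n ^ 2`. The invariant sets `A` are therefore
separated into two kinds.

* If `A` lies in the set `F` of fixed points of `σ`, then `τ` has a cycle inside `F`. This has
  probability at most `|F| / n ≤ m / n` (`card_exists_isInv_subset_le`).
* Otherwise `A` contains a cycle of `σ` of length at least two. For each of the at most `m` such
  cycles, the union bound over the `A` containing it runs over sets `T` of other cycles, with
  `|A| ≥ |T| + 2`, and the resulting sum `∑ 1 / n.choose (|T| + 2)` has a closed form of order
  `1 / n ^ 2` (`sum_powerset_inv_choose`, `sum_isInv_inv_choose_le`).

Hence the surface is disconnected with probability at most `m / n + 16 * m / n ^ 2`, and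
`m ≤ n ^ α` gives the stated estimate.
-/

/-! ### Invariant sets and connectedness of the surface -/

/-- The finite set `A` is a union of cycles of the permutation `σ`. -/
def IsInv {α : Type*} (σ : Equiv.Perm α) (A : Finset α) : Prop :=
  ∀ i, σ i ∈ A ↔ i ∈ A

instance {α : Type*} [Fintype α] [DecidableEq α] (σ : Equiv.Perm α) (A : Finset α) :
    Decidable (IsInv σ A) :=
  inferInstanceAs (Decidable (∀ i, σ i ∈ A ↔ i ∈ A))

theorem IsInv.compl {α : Type*} [Fintype α] [DecidableEq α] {σ : Equiv.Perm α} {A : Finset α}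
    (h : IsInv σ A) : IsInv σ Aᶜ := fun i => by
  simp only [Finset.mem_compl, h i]

namespace SquareTiledSurface

theorem exists_isInv_of_not_connectedSpace {n : ℕ} (hn : 0 < n) {σ τ : Equiv.Perm (Fin n)}
    (h : ¬ ConnectedSpace (SquareTiledSurface σ τ)) :
    ∃ A : Finset (Fin n), A.Nonempty ∧ A ≠ Finset.univ ∧ IsInv σ A ∧ IsInv τ A := by
  by_contra hA
  refine h ?_
  let p : Fin n × unitInterval × unitInterval → SquareTiledSurface σ τ := Quot.mk _
  have hp : Continuous p := continuous_quot_mk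
  have : Nonempty (SquareTiledSurface σ τ) := ⟨p (⟨0, hn⟩, 0, 0)⟩
  refine @ConnectedSpace.mk _ _ ?_ this
  rw [preconnectedSpace_iff_clopen]
  intro U hU
  -- a clopen set meeting the image of a closed square contains that image
  have hsq : ∀ i x y, p (i, x, y) ∈ U ↔ p (i, 0, 0) ∈ U := by
    intro i x y
    have hc : Continuous fun z : unitInterval × unitInterval => p (i, z) := by fun_prop
    rcases isClopen_iff.mp (hU.preimage hc) with h0 | h0
    · have h1 : ∀ z, p (i, z) ∉ U := fun z hz => by
        have : z ∈ (fun z => p (i, z)) ⁻¹' U := hz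
        rw [h0] at this; exact this
      simp [h1]
    · have h1 : ∀ z, p (i, z) ∈ U := fun z => by
        have : z ∈ (fun z => p (i, z)) ⁻¹' U := by rw [h0]; trivial
        exact this
      simp [h1]
  classical
  let A : Finset (Fin n) := Finset.univ.filter fun i => p (i, 0, 0) ∈ U
  have hmem : ∀ i, i ∈ A ↔ p (i, 0, 0) ∈ U := fun i => by simp [A]
  have hσ : IsInv σ A := fun i => by
    rw [hmem, hmem, ← hsq i 1 0]
    exact iff_of_eq (congrArg (· ∈ U) (Quot.sound (SquareGluing.horizontal i 0)).symm)
  have hτ : IsInv τ A := fun i => by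
    rw [hmem, hmem, ← hsq i 0 1]
    exact iff_of_eq (congrArg (· ∈ U) (Quot.sound (SquareGluing.vertical i 0)).symm)
  rcases A.eq_empty_or_nonempty with h0 | h0
  · left
    ext z
    obtain ⟨⟨i, x, y⟩, rfl⟩ := Quot.exists_rep z
    have : i ∉ A := by simp [h0]
    rw [hmem, ← hsq i x y] at this
    exact iff_of_false this (Set.notMem_empty _)
  · right
    have h1 : A = Finset.univ := by
      by_contra h1
      exact hA ⟨A, h0, h1, hσ, hτ⟩
    ext z
    obtain ⟨⟨i, x, y⟩, rfl⟩ := Quot.exists_rep z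
    have : i ∈ A := by simp [h1]
    rw [hmem, ← hsq i x y] at this
    exact iff_of_true this (Set.mem_univ _)

theorem exists_small_isInv_of_not_connectedSpace {n : ℕ} (hn : 0 < n) {σ τ : Equiv.Perm (Fin n)}
    (h : ¬ ConnectedSpace (SquareTiledSurface σ τ)) :
    ∃ A : Finset (Fin n), A.Nonempty ∧ 2 * A.card ≤ n ∧ IsInv σ A ∧ IsInv τ A := by
  obtain ⟨A, hne, hA, hσ, hτ⟩ := exists_isInv_of_not_connectedSpace hn h
  by_cases hc : 2 * A.card ≤ n
  · exact ⟨A, hne, hc, hσ, hτ⟩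
  · refine ⟨Aᶜ, ?_, ?_, hσ.compl, hτ.compl⟩
    · rwa [Finset.nonempty_iff_ne_empty, Ne, Finset.compl_eq_empty_iff]
    · rw [Finset.card_compl, Fintype.card_fin]
      omega

theorem not_connectedSpace_of_isInv {n : ℕ} {σ τ : Equiv.Perm (Fin n)} {A : Finset (Fin n)}
    (hne : A.Nonempty) (hA : A ≠ Finset.univ) (hσ : IsInv σ A) (hτ : IsInv τ A) :
    ¬ ConnectedSpace (SquareTiledSurface σ τ) := by
  intro h
  -- membership in `A` descends to a continuous function on the surface
  let f : SquareTiledSurface σ τ → Bool := Quot.lift (fun z => decide (z.1 ∈ A)) (by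
    rintro _ _ (⟨i, y⟩ | ⟨i, x⟩)
    · simp [hσ i]
    · simp [hτ i])
  have hf : Continuous f := by
    refine continuous_quot_lift _ ?_
    exact (continuous_of_discreteTopology (f := fun i : Fin n => decide (i ∈ A))).comp
      continuous_fst
  obtain ⟨a, ha⟩ := hne
  obtain ⟨b, hb⟩ : ∃ b, b ∉ A := by
    by_contra hb
    push Not at hb
    exact hA (Finset.eq_univ_iff_forall.mpr hb)
  have hab := PreconnectedSpace.constant h.toPreconnectedSpace hf
    (x := Quot.mk _ (a, 0, 0)) (y := Quot.mk _ (b, 0, 0))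
  simp [f, ha, hb] at hab

end SquareTiledSurface

/-! ### Counting permutations with invariant sets -/

theorem card_isInv {α : Type*} [Fintype α] [DecidableEq α] (A : Finset α) :
    (Finset.univ.filter fun σ : Equiv.Perm α => IsInv σ A).card =
      A.card.factorial * (Fintype.card α - A.card).factorial := by
  have h := DomMulAct.stabilizer_card (fun i : α => decide (i ∈ A))
  rw [Fintype.card_subtype] at h
  rw [Fintype.prod_bool] at h
  simp only [Fintype.card_subtype, decide_eq_true_eq, decide_eq_false_iff_not] at h
  rw [show (Finset.univ.filter fun i => i ∈ A) = A by ext; simp,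
    show (Finset.univ.filter fun i => i ∉ A) = Aᶜ by ext; simp, Finset.card_compl] at h
  rw [← h]
  congr 1
  ext σ
  rw [Finset.mem_filter, Finset.mem_filter]
  simp [IsInv, funext_iff]

theorem card_isInv_eq_div_choose {α : Type*} [Fintype α] [DecidableEq α] (A : Finset α) :
    ((Finset.univ.filter fun σ : Equiv.Perm α => IsInv σ A).card : ℝ) =
      (Fintype.card α).factorial / (Fintype.card α).choose A.card := by
  have h := Nat.choose_mul_factorial_mul_factorial A.card_le_univ
  have h0 : (0 : ℝ) < (Fintype.card α).choose A.card := by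
    exact_mod_cast Nat.choose_pos A.card_le_univ
  rw [card_isInv, eq_div_iff h0.ne', ← h]
  push_cast
  ring

/-- A random permutation of an `n`-element set has a cycle inside `F` with probability at most
`|F| / n`. Removing a point `a ∈ F` from its cycle, a cycle inside `F` remains a cycle inside
`F \ {a}` unless `a` is a fixed point. -/
theorem card_exists_isInv_subset_le {α : Type*} [Fintype α] [DecidableEq α] (F : Finset α) :
    (Finset.univ.filter fun τ : Equiv.Perm α => ∃ A ⊆ F, A.Nonempty ∧ IsInv τ A).card ≤
      F.card * (Fintype.card α - 1).factorial := by
  induction hk : F.card generalizing α with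
  | zero =>
    rw [Finset.card_eq_zero] at hk
    subst hk
    simp only [zero_mul, nonpos_iff_eq_zero, Finset.card_eq_zero, Finset.filter_eq_empty_iff]
    rintro τ - ⟨A, hA, hne, -⟩
    simp [Finset.subset_empty.mp hA] at hne
  | succ k ih =>
    obtain ⟨a, ha⟩ : F.Nonempty := Finset.card_pos.mp (by omega)
    let β := {b : α // b ≠ a}
    let e : Option β ≃ α := Equiv.optionSubtypeNe a
    let F' : Finset β := Finset.univ.filter fun b => (b : α) ∈ F
    have hF' : F'.card = k := by
      have h1 : F'.map (Function.Embedding.subtype _) = F.erase a := by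
        ext b
        simp [F', β, and_comm]
      rw [← Finset.card_map, h1, Finset.card_erase_of_mem ha, hk, Nat.add_sub_cancel]
    have hβ : Fintype.card β = Fintype.card α - 1 := by
      simp [β]
    have hih := ih F' hF'
    let bad : Finset (Equiv.Perm β) :=
      Finset.univ.filter fun τ => ∃ A ⊆ F', A.Nonempty ∧ IsInv τ A
    let φ : Equiv.Perm α ≃ Option β × Equiv.Perm β :=
      (Equiv.permCongr e.symm).trans Equiv.Perm.decomposeOption
    -- `φ τ` records the image of `a` and the permutation obtained by excising `a` from its cycle
    have hsub : (Finset.univ.filter fun τ : Equiv.Perm α => ∃ A ⊆ F, A.Nonempty ∧ IsInv τ A).map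
        φ.toEmbedding ⊆ ({none} ×ˢ Finset.univ) ∪ ((Finset.univ.erase none) ×ˢ bad) := by
      intro q hq
      rw [Finset.mem_map] at hq
      obtain ⟨τ, hτ, rfl⟩ := hq
      rw [Finset.mem_filter] at hτ
      obtain ⟨-, A, hAF, hne, hA⟩ := hτ
      set ρ : Equiv.Perm (Option β) := Equiv.permCongr e.symm τ with hρ
      have hφ : φ τ = (ρ none, Equiv.removeNone ρ) := rfl
      have hφ' : φ.toEmbedding τ = (ρ none, Equiv.removeNone ρ) := rfl
      rw [hφ']
      have hρA : ∀ x, e (ρ x) ∈ A ↔ e x ∈ A := fun x => by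
        simpa [hρ, Equiv.permCongr_apply] using hA (e x)
      by_cases h0 : ρ none = none
      · simp [h0]
      -- `A` is not `{a}`, so it meets `β` in a nonempty set invariant after the excision
      · refine Finset.mem_union_right _ ?_
        simp only [Finset.mem_product, Finset.mem_erase, ne_eq, h0, not_false_eq_true,
          Finset.mem_univ, and_self, true_and, bad, Finset.mem_filter]
        refine ⟨Finset.univ.filter fun b => (b : α) ∈ A, ?_, ?_, ?_⟩
        · intro b hb
          simp only [F', Finset.mem_filter, Finset.mem_univ, true_and] at hb ⊢
          exact hAF hb
        · obtain ⟨b, hb⟩ := hne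
          by_cases hba : b = a
          · obtain ⟨c, hc⟩ := Option.ne_none_iff_exists'.mp h0
            refine ⟨c, ?_⟩
            have := (hρA none).mpr (show a ∈ A from hba ▸ hb)
            rw [hc] at this
            rw [Finset.mem_filter]
            exact ⟨Finset.mem_univ _, this⟩
          · exact ⟨⟨b, hba⟩, by simpa using hb⟩
        · intro b
          simp only [Finset.mem_filter, Finset.mem_univ, true_and]
          have hb : (e (some b) ∈ A) = ((b : α) ∈ A) := rfl
          have hb' : ∀ c : β, (c : α) = e (some c) := fun c => rfl
          rw [hb' b, hb']
          by_cases h1 : ∃ c, ρ (some b) = some c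
          · rw [Equiv.removeNone_some ρ h1, hρA]
          · have h1' : ρ (some b) = none := by
              by_contra h2
              exact h1 (Option.ne_none_iff_exists'.mp h2)
            rw [Equiv.removeNone_none ρ h1', hρA, ← hρA (some b), h1']
    have hcard := Finset.card_le_card hsub
    rw [Finset.card_map] at hcard
    refine hcard.trans ((Finset.card_union_le _ _).trans ?_)
    rw [Finset.card_product, Finset.card_product, Finset.card_erase_of_mem (Finset.mem_univ _),
      Finset.card_univ, Finset.card_univ, Fintype.card_option, Fintype.card_perm, hβ,
      Nat.add_sub_cancel, Finset.card_singleton, one_mul, add_mul, one_mul, add_comm]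
    refine Nat.add_le_add_right ?_ _
    rw [hβ] at hih
    rcases Nat.eq_zero_or_pos (Fintype.card α - 1) with h0 | h0
    · simp [h0]
    · calc (Fintype.card α - 1) * bad.card
          ≤ (Fintype.card α - 1) * (k * (Fintype.card α - 1 - 1).factorial) :=
            Nat.mul_le_mul_left _ hih
        _ = k * ((Fintype.card α - 1) * (Fintype.card α - 1 - 1).factorial) := by ring
        _ = k * (Fintype.card α - 1).factorial := by rw [Nat.mul_factorial_pred h0.ne']

theorem inv_choose_succ_add_inv_choose_succ {r k : ℕ} (h : k ≤ r) :
    1 / ((r + 1).choose k : ℝ) + 1 / ((r + 1).choose (k + 1) : ℝ) =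
      (r + 2) / ((r + 1) * r.choose k) := by
  have h1 : (0 : ℝ) < r.choose k := by exact_mod_cast Nat.choose_pos h
  have h2 : (0 : ℝ) < (r + 1).choose k := by exact_mod_cast Nat.choose_pos (by omega)
  have h3 : (0 : ℝ) < (r + 1).choose (k + 1) := by exact_mod_cast Nat.choose_pos (by omega)
  have e1 : ((r + 1).choose k : ℝ) * (r + 1 - k) = (r + 1) * r.choose k := by
    have := Nat.choose_mul_succ_eq r k
    have hc : ((r + 1 - k : ℕ) : ℝ) = r + 1 - k := by rw [Nat.cast_sub (by omega)]; push_cast; ring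
    rw [← hc]
    have h := congrArg (Nat.cast : ℕ → ℝ) this
    push_cast at h ⊢
    linarith
  have e2 : ((r + 1).choose (k + 1) : ℝ) * (k + 1) = (r + 1) * r.choose k := by
    have := Nat.add_one_mul_choose_eq r k
    have h := congrArg (Nat.cast : ℕ → ℝ) this
    push_cast at h ⊢
    linarith
  have f1 : 1 / ((r + 1).choose k : ℝ) = (r + 1 - k) / ((r + 1) * r.choose k) := by
    rw [← e1, div_mul_cancel_right₀ (by
      have : (k : ℝ) ≤ r := by exact_mod_cast h
      linarith), one_div]
  have f2 : 1 / ((r + 1).choose (k + 1) : ℝ) = (k + 1) / ((r + 1) * r.choose k) := by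
    rw [← e2, div_mul_cancel_right₀ (by positivity), one_div]
  rw [f1, f2, ← add_div]
  ring

/-- The closed form can be read off from the beta integral
`1 / n.choose k = (n + 1) * ∫ x ^ k * (1 - x) ^ (n - k)` over `[0, 1]`, under which the sum over
subsets is a binomial expansion. The proof is by induction on `B`. -/
theorem sum_powerset_inv_choose {α : Type*} [DecidableEq α] (B : Finset α) {k r : ℕ} (h : k ≤ r) :
    ∑ T ∈ B.powerset, 1 / ((B.card + r).choose (T.card + k) : ℝ) =
      (B.card + r + 1) / ((r + 1) * r.choose k) := by
  induction B using Finset.induction_on generalizing k r with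
  | empty =>
    have : (r : ℝ) + 1 ≠ 0 := by positivity
    simp only [Finset.powerset_empty, Finset.sum_singleton, Finset.card_empty, zero_add,
      Nat.cast_zero]
    rw [div_mul_cancel_left₀ this, one_div]
  | insert a B ha ih =>
    rw [Finset.sum_powerset_insert ha, Finset.card_insert_of_notMem ha]
    have e : B.card + 1 + r = B.card + (r + 1) := by ring
    have h2 : ∀ T ∈ B.powerset, 1 / ((B.card + 1 + r).choose ((insert a T).card + k) : ℝ) =
        1 / ((B.card + (r + 1)).choose (T.card + (k + 1)) : ℝ) := by
      intro T hT
      rw [Finset.card_insert_of_notMem fun h => ha (Finset.mem_powerset.mp hT h), e]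
      congr 3
      ring
    rw [Finset.sum_congr rfl h2, e, ih (by omega), ih (by omega)]
    have h3 := inv_choose_succ_add_inv_choose_succ h
    have h4 : ((r : ℝ) + 2) ≠ 0 := by positivity
    calc _ = ((B.card : ℝ) + (r + 1) + 1) / (r + 2) *
          (1 / ((r + 1).choose k : ℝ) + 1 / ((r + 1).choose (k + 1) : ℝ)) := by
            push_cast
            rw [show (r : ℝ) + 1 + 1 = r + 2 by ring, mul_add, div_mul_div_comm, div_mul_div_comm,
              mul_one]
      _ = _ := by
            rw [h3, div_mul_div_comm, mul_comm (_ + _ + _ : ℝ), mul_div_mul_left _ _ h4]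
            push_cast
            ring_nf

theorem choose_le_choose_of_le_half {n i j : ℕ} (hij : i ≤ j) (hj : 2 * j ≤ n) :
    n.choose i ≤ n.choose j := by
  induction j, hij using Nat.le_induction with
  | base => exact le_rfl
  | succ j _ ih => exact (ih (by omega)).trans (Nat.choose_le_succ_of_lt_half_left (by omega))

/-! ### The restricted model with a fixed horizontal permutation -/

theorem IsInv.mem_iff_of_sameCycle {α : Type*} {σ : Equiv.Perm α} {A : Finset α} (h : IsInv σ A)
    {x y : α} (hxy : σ.SameCycle x y) : x ∈ A ↔ y ∈ A := by
  obtain ⟨k, rfl⟩ := hxy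
  induction k using Int.induction_on with
  | zero => simp
  | succ k ih => rw [ih, add_comm, zpow_add, zpow_one, Equiv.Perm.mul_apply, h]
  | pred k ih =>
    rw [ih, ← h ((σ ^ (-(k : ℤ) - 1)) x), ← Equiv.Perm.mul_apply, ← zpow_one_add]
    congr! 3
    ring_nf

/-- A set containing exactly one point of each cycle of `σ`, fixed points included. -/
theorem exists_cycle_representatives {α : Type*} [Fintype α] [DecidableEq α] (σ : Equiv.Perm α) :
    ∃ B : Finset α, B.card ≤ Multiset.card σ.partition.parts ∧
      (∀ i, ∃ b ∈ B, σ.SameCycle b i) ∧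
      ∀ b ∈ B, ∀ b' ∈ B, σ.SameCycle b b' → b = b' := by
  classical
  let s : Setoid α := Equiv.Perm.SameCycle.setoid σ
  let r : α → α := fun i => (Quotient.mk s i).out
  have hr : ∀ i, σ.SameCycle (r i) i := fun i => Quotient.mk_out (s := s) i
  have hr' : ∀ i j, σ.SameCycle i j → r i = r j := fun i j h =>
    congrArg Quotient.out (Quotient.sound (s := s) h)
  let B := Finset.univ.image r
  have hB : ∀ b ∈ B, ∀ b' ∈ B, σ.SameCycle b b' → b = b' := by
    intro b hb b' hb' h
    obtain ⟨i, -, rfl⟩ := Finset.mem_image.mp hb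
    obtain ⟨j, -, rfl⟩ := Finset.mem_image.mp hb'
    exact hr' i j ((hr i).symm.trans (h.trans (hr j)))
  refine ⟨B, ?_, fun i => ⟨r i, Finset.mem_image_of_mem _ (Finset.mem_univ i), hr i⟩, hB⟩
  rw [Equiv.Perm.parts_partition, Multiset.card_add, Multiset.card_replicate,
    Equiv.Perm.cycleType_def, Multiset.card_map,
    ← Finset.card_inter_add_card_sdiff B σ.support, ← Finset.card_compl]
  refine Nat.add_le_add ?_ (Finset.card_le_card fun i hi => ?_)
  · refine Finset.card_le_card_of_injOn (fun b => σ.cycleOf b) (fun b hb => ?_) ?_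
    · exact Equiv.Perm.cycleOf_mem_cycleFactorsFinset_iff.mpr (Finset.mem_inter.mp hb).2
    · intro b hb b' hb' h
      have hb := Finset.mem_inter.mp hb
      have hb' := Finset.mem_inter.mp hb'
      exact hB b hb.1 b' hb'.1
        ((Equiv.Perm.sameCycle_iff_cycleOf_eq_of_mem_support hb.2 hb'.2).mpr h)
  · rw [Finset.mem_compl]
    exact (Finset.mem_sdiff.mp hi).2

/-- An invariant set containing a given non-fixed representative `b` is determined by the other
representatives that it contains, and it has at least one element besides its representatives. -/
theorem sum_isInv_inv_choose_le {α : Type*} [Fintype α] [DecidableEq α] {σ : Equiv.Perm α}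
    {B : Finset α} (hB : ∀ i, ∃ b ∈ B, σ.SameCycle b i)
    (hB' : ∀ b ∈ B, ∀ b' ∈ B, σ.SameCycle b b' → b = b') (hBn : 2 * B.card ≤ Fintype.card α)
    {b : α} (hb : b ∈ B) (hσb : σ b ≠ b) :
    ∑ A : Finset α with IsInv σ A ∧ b ∈ A ∧ 2 * A.card ≤ Fintype.card α,
        1 / ((Fintype.card α).choose A.card : ℝ) ≤ 16 / (Fintype.card α : ℝ) ^ 2 := by
  set n := Fintype.card α with hn
  have hBpos : 0 < B.card := Finset.card_pos.mpr ⟨b, hb⟩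
  have hcard : (B.erase b).card = B.card - 1 := Finset.card_erase_of_mem hb
  obtain ⟨r, hr⟩ : ∃ r, (B.erase b).card + r = n := ⟨n - (B.card - 1), by omega⟩
  have hinj : Set.InjOn (fun A : Finset α => (A ∩ B).erase b)
      (Finset.univ.filter fun A : Finset α => IsInv σ A ∧ b ∈ A ∧ 2 * A.card ≤ n) := by
    intro A hA A' hA' h
    obtain ⟨-, hA, hbA, -⟩ := Finset.mem_filter.mp hA
    obtain ⟨-, hA', hbA', -⟩ := Finset.mem_filter.mp hA'
    have h1 : A ∩ B = A' ∩ B := by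
      rw [← Finset.insert_erase (Finset.mem_inter.mpr ⟨hbA, hb⟩),
        ← Finset.insert_erase (Finset.mem_inter.mpr ⟨hbA', hb⟩)]
      exact congrArg (insert b) h
    ext i
    obtain ⟨c, hc, hci⟩ := hB i
    rw [← hA.mem_iff_of_sameCycle hci, ← hA'.mem_iff_of_sameCycle hci]
    have := Finset.ext_iff.mp h1 c
    simpa [hc] using this
  calc _ ≤ ∑ A : Finset α with IsInv σ A ∧ b ∈ A ∧ 2 * A.card ≤ n,
        1 / (n.choose (((A ∩ B).erase b).card + 2) : ℝ) := by
        refine Finset.sum_le_sum fun A hA => ?_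
        obtain ⟨-, hA, hbA, hAn⟩ := Finset.mem_filter.mp hA
        have hbAB : b ∈ A ∩ B := Finset.mem_inter.mpr ⟨hbA, hb⟩
        -- the point `σ b` of `A` is not a representative
        have hlt : (A ∩ B).card < A.card := by
          refine Finset.card_lt_card (Finset.ssubset_iff_subset_ne.mpr
            ⟨Finset.inter_subset_left, fun h => ?_⟩)
          have h1 : σ b ∈ A ∩ B := by rw [h]; exact (hA b).mpr hbA
          exact hσb (hB' b hb (σ b) (Finset.mem_inter.mp h1).2 ⟨1, by simp⟩).symm
        have hle : ((A ∩ B).erase b).card + 2 ≤ A.card := by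
          rw [Finset.card_erase_of_mem hbAB]
          have := Finset.card_pos.mpr ⟨b, hbAB⟩
          omega
        refine one_div_le_one_div_of_le ?_ ?_
        · exact_mod_cast Nat.choose_pos (by omega)
        · exact_mod_cast choose_le_choose_of_le_half hle hAn
    _ = ∑ T ∈ (Finset.univ.filter fun A : Finset α => IsInv σ A ∧ b ∈ A ∧ 2 * A.card ≤ n).image
          (fun A => (A ∩ B).erase b), 1 / (n.choose (T.card + 2) : ℝ) := by
        rw [Finset.sum_image hinj]
    _ ≤ ∑ T ∈ (B.erase b).powerset, 1 / (n.choose (T.card + 2) : ℝ) := by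
        refine Finset.sum_le_sum_of_subset_of_nonneg (fun T hT => ?_) fun _ _ _ => by positivity
        obtain ⟨A, -, rfl⟩ := Finset.mem_image.mp hT
        exact Finset.mem_powerset.mpr (Finset.erase_subset_erase _ Finset.inter_subset_right)
    _ = (n + 1) / ((r + 1) * r.choose 2) := by
        have := sum_powerset_inv_choose (B.erase b) (k := 2) (r := r) (by omega)
        rw [hr] at this
        rw [this, ← hr]
        push_cast
        ring
    _ ≤ 16 / (n : ℝ) ^ 2 := by
        have h1 : (n : ℝ) + 2 ≤ 2 * r := by
          have : n + 2 ≤ 2 * r := by omega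
          exact_mod_cast this
        have hn1 : (1 : ℝ) ≤ n := by
          have : 1 ≤ n := by omega
          exact_mod_cast this
        rw [Nat.cast_choose_two]
        rw [div_le_div_iff₀ (mul_pos (by linarith) (div_pos (mul_pos (by linarith)
          (by linarith)) two_pos)) (by positivity)]
        have h2 : (n : ℝ) ^ 2 ≤ 4 * (r * (r - 1)) := by nlinarith
        have h3 : (n : ℝ) + 1 ≤ 2 * (r + 1) := by linarith
        nlinarith [mul_le_mul h3 h2 (by positivity) (by linarith)]

/-- The proportion of the permutations `τ` for which `S(σ, τ)` is disconnected. The main term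
comes from cycles of `τ` made of fixed points of `σ`, each remaining cycle of `σ` contributes
`O(1 / n ^ 2)` through the invariant sets that contain it. -/
theorem card_not_connectedSpace_le {n : ℕ} (hn : 0 < n) (σ : Equiv.Perm (Fin n)) {m : ℕ}
    (hm : Multiset.card σ.partition.parts = m) (hmn : 2 * m ≤ n) :
    ({τ | ¬ ConnectedSpace (SquareTiledSurface σ τ)}.ncard : ℝ) ≤
      n.factorial * (m / n + 16 * m / (n : ℝ) ^ 2) := by
  classical
  obtain ⟨B, hBm, hB, hB'⟩ := exists_cycle_representatives σ
  rw [hm] at hBm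
  let F : Finset (Fin n) := Finset.univ.filter fun i => σ i = i
  have hFm : F.card ≤ m := by
    have : F = σ.supportᶜ := by ext; simp [F]
    rw [← hm, Equiv.Perm.parts_partition, Multiset.card_add, Multiset.card_replicate, this,
      Finset.card_compl]
    omega
  let bad : Finset (Equiv.Perm (Fin n)) :=
    Finset.univ.filter fun τ => ∃ A ⊆ F, A.Nonempty ∧ IsInv τ A
  let S : Fin n → Finset (Finset (Fin n)) := fun b =>
    Finset.univ.filter fun A => IsInv σ A ∧ b ∈ A ∧ 2 * A.card ≤ Fintype.card (Fin n)
  let G : Finset (Fin n) := B.filter fun b => σ b ≠ b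
  have hsub : {τ | ¬ ConnectedSpace (SquareTiledSurface σ τ)} ⊆
      (bad ∪ G.biUnion fun b => (S b).biUnion fun A =>
        Finset.univ.filter fun τ => IsInv τ A : Finset (Equiv.Perm (Fin n))) := by
    intro τ hτ
    obtain ⟨A, hne, hAn, hAσ, hAτ⟩ :=
      SquareTiledSurface.exists_small_isInv_of_not_connectedSpace hn hτ
    rw [Finset.mem_coe, Finset.mem_union]
    by_cases hAF : A ⊆ F
    · exact Or.inl (Finset.mem_filter.mpr ⟨Finset.mem_univ _, A, hAF, hne, hAτ⟩)
    · right
      obtain ⟨i, hiA, hiF⟩ := Finset.not_subset.mp hAF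
      obtain ⟨b, hb, hbi⟩ := hB i
      have hσb : σ b ≠ b := fun h => hiF (by
        simpa [F] using (hbi.apply_eq_self_iff).mp h)
      simp only [Finset.mem_biUnion, Finset.mem_filter, Finset.mem_univ, true_and, G, S,
        Fintype.card_fin]
      exact ⟨b, ⟨hb, hσb⟩, A, ⟨hAσ, (hAσ.mem_iff_of_sameCycle hbi).mpr hiA, hAn⟩, hAτ⟩
  have hle := Set.ncard_le_ncard hsub (Finset.finite_toSet _)
  rw [Set.ncard_coe_finset] at hle
  have hnf : (n.factorial : ℝ) = n * (n - 1).factorial := by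
    exact_mod_cast (Nat.mul_factorial_pred hn.ne').symm
  have hn0 : (n : ℝ) ≠ 0 := by positivity
  have hbad : (bad.card : ℝ) ≤ n.factorial * (m / n) := by
    have h1 := card_exists_isInv_subset_le F
    rw [Fintype.card_fin] at h1
    calc (bad.card : ℝ) ≤ F.card * (n - 1).factorial := by exact_mod_cast h1
      _ ≤ m * (n - 1).factorial := by gcongr
      _ = n.factorial * (m / n) := by rw [hnf]; field_simp
  have hS : ∀ b ∈ G, (((S b).biUnion fun A =>
      Finset.univ.filter fun τ : Equiv.Perm (Fin n) => IsInv τ A).card : ℝ) ≤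
        n.factorial * (16 / (n : ℝ) ^ 2) := by
    intro b hb
    have hb := Finset.mem_filter.mp hb
    have h1 := sum_isInv_inv_choose_le hB hB' (by rw [Fintype.card_fin]; omega) hb.1 hb.2
    calc _ ≤ ∑ A ∈ S b, ((Finset.univ.filter fun τ : Equiv.Perm (Fin n) => IsInv τ A).card : ℝ) :=
          by exact_mod_cast Finset.card_biUnion_le
      _ = n.factorial * ∑ A ∈ S b, 1 / ((Fintype.card (Fin n)).choose A.card : ℝ) := by
          rw [Finset.mul_sum]
          refine Finset.sum_congr rfl fun A _ => ?_
          rw [card_isInv_eq_div_choose, Fintype.card_fin, mul_one_div]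
      _ ≤ n.factorial * (16 / (n : ℝ) ^ 2) := by
          rw [Fintype.card_fin] at h1
          gcongr
          simpa [S] using h1
  calc _ ≤ ((bad ∪ G.biUnion fun b => (S b).biUnion fun A =>
        Finset.univ.filter fun τ => IsInv τ A : Finset (Equiv.Perm (Fin n))).card : ℝ) := by
        exact_mod_cast hle
    _ ≤ bad.card + ∑ b ∈ G, (((S b).biUnion fun A =>
        Finset.univ.filter fun τ : Equiv.Perm (Fin n) => IsInv τ A).card : ℝ) := by
        exact_mod_cast (Finset.card_union_le _ _).trans
          (Nat.add_le_add_left Finset.card_biUnion_le _)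
    _ ≤ n.factorial * (m / n) + ∑ b ∈ G, n.factorial * (16 / (n : ℝ) ^ 2) :=
        add_le_add hbad (Finset.sum_le_sum hS)
    _ ≤ n.factorial * (m / n) + m * (n.factorial * (16 / (n : ℝ) ^ 2)) := by
        rw [Finset.sum_const, nsmul_eq_mul]
        gcongr
        exact (Finset.card_filter_le _ _).trans hBm
    _ = _ := by ring

theorem cycleTypeClass_nonempty {n : ℕ} (μ : n.Partition) : (cycleTypeClass μ).Nonempty := by
  have hsplit := Multiset.filter_add_not (fun k => 2 ≤ k) μ.parts
  have hones : μ.parts.filter (fun k => ¬ 2 ≤ k) =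
      Multiset.replicate (Multiset.card (μ.parts.filter fun k => ¬ 2 ≤ k)) 1 := by
    rw [Multiset.eq_replicate_card]
    intro k hk
    have h := Multiset.mem_filter.mp hk
    have := μ.parts_pos h.1
    omega
  have hsum : (μ.parts.filter fun k => 2 ≤ k).sum +
      Multiset.card (μ.parts.filter fun k => ¬ 2 ≤ k) = n := by
    have h := congrArg Multiset.sum hsplit
    rw [Multiset.sum_add, μ.parts_sum, hones, Multiset.sum_replicate] at h
    simpa using h
  obtain ⟨σ, hσ⟩ := (Equiv.Perm.exists_with_cycleType_iff (Fin n)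
    (m := μ.parts.filter fun k => 2 ≤ k)).mpr
      ⟨by rw [Fintype.card_fin]; omega, fun k hk => (Multiset.mem_filter.mp hk).2⟩
  refine ⟨σ, ?_⟩
  change σ.partition.parts = μ.parts
  rw [Equiv.Perm.parts_partition, ← Equiv.Perm.sum_cycleType, hσ, Fintype.card_fin,
    Nat.sub_eq_of_eq_add' hsum.symm, ← hones, hsplit]

/-! ### Uniform probabilities -/

theorem uniformProb_eq_one_sub {Ω : Type} [Finite Ω] {X : Set Ω} (hX : X.Nonempty) (E : Set Ω) :
    uniformProb X E = 1 - ((X \ E).ncard : ℝ) / X.ncard := by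
  have h0 : (X.ncard : ℝ) ≠ 0 := by
    exact_mod_cast (Set.ncard_pos X.toFinite).mpr hX |>.ne'
  have h : ((X ∩ E).ncard : ℝ) + (X \ E).ncard = X.ncard := by
    exact_mod_cast Set.ncard_inter_add_ncard_sdiff_eq_ncard X E X.toFinite
  rw [uniformProb_eq, eq_sub_iff_add_eq, ← add_div, h, div_self h0]

theorem uniformProb_le_one {Ω : Type} [Finite Ω] {X : Set Ω} (hX : X.Nonempty) (E : Set Ω) :
    uniformProb X E ≤ 1 := by
  rw [uniformProb_eq_one_sub hX]
  have : (0 : ℝ) ≤ ((X \ E).ncard : ℝ) / X.ncard := by positivity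
  linarith

theorem one_sub_le_uniformProb_prod_univ {Ω Ω' : Type} [Finite Ω] [Finite Ω'] [Nonempty Ω']
    {K : Set Ω} (hK : K.Nonempty) {E : Set (Ω × Ω')} {ε : ℝ}
    (h : ∀ x ∈ K, ({y | (x, y) ∉ E}.ncard : ℝ) ≤ Nat.card Ω' * ε) :
    1 - ε ≤ uniformProb (K ×ˢ Set.univ) E := by
  classical
  rw [uniformProb_eq_one_sub (hK.prod Set.univ_nonempty), Set.ncard_prod, Set.ncard_univ]
  have hK0 : (0 : ℝ) < K.ncard := by exact_mod_cast (Set.ncard_pos K.toFinite).mpr hK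
  have hΩ : (0 : ℝ) < Nat.card Ω' := by exact_mod_cast Nat.card_pos
  have hcard : (((K ×ˢ Set.univ) \ E).ncard : ℝ) ≤ K.ncard * (Nat.card Ω' * ε) := by
    have hsub : (K ×ˢ Set.univ) \ E ⊆
        ⋃ x ∈ K.toFinite.toFinset, Prod.mk x '' {y | (x, y) ∉ E} := by
      rintro ⟨x, y⟩ ⟨⟨hx, -⟩, hxy⟩
      simp only [Set.mem_iUnion]
      exact ⟨x, by simpa using hx, y, hxy, rfl⟩
    have h1 := (Set.ncard_le_ncard hsub (Set.toFinite _)).trans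
      (Finset.set_ncard_biUnion_le _ _)
    calc (((K ×ˢ Set.univ) \ E).ncard : ℝ)
        ≤ ∑ x ∈ K.toFinite.toFinset, ((Prod.mk x '' {y | (x, y) ∉ E}).ncard : ℝ) := by
          exact_mod_cast h1
      _ ≤ ∑ x ∈ K.toFinite.toFinset, Nat.card Ω' * ε := by
          refine Finset.sum_le_sum fun x hx => ?_
          rw [Set.ncard_image_of_injective _ (Prod.mk_right_injective x)]
          exact h x (by simpa using hx)
      _ = _ := by rw [Finset.sum_const, nsmul_eq_mul, Set.ncard_eq_toFinset_card K K.toFinite]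
  have : (((K ×ˢ Set.univ) \ E).ncard : ℝ) / ((K.ncard * Nat.card Ω' : ℕ) : ℝ) ≤ ε := by
    rw [Nat.cast_mul, div_le_iff₀ (mul_pos hK0 hΩ)]
    linarith
  linarith

/-! ### The restricted model -/

theorem one_sub_le_hrConnectedProb {n : ℕ} (hn : 0 < n) (μ : n.Partition)
    (hμ : 2 * Multiset.card μ.parts ≤ n) :
    1 - ((Multiset.card μ.parts : ℝ) / n + 16 * Multiset.card μ.parts / (n : ℝ) ^ 2) ≤
      hrConnectedProb μ := by
  refine one_sub_le_uniformProb_prod_univ (cycleTypeClass_nonempty μ) fun σ hσ => ?_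
  rw [Nat.card_perm, Nat.card_fin]
  exact card_not_connectedSpace_le hn σ (congrArg Multiset.card hσ) hμ

theorem hrConnectedProb_le_one {n : ℕ} (μ : n.Partition) : hrConnectedProb μ ≤ 1 :=
  uniformProb_le_one ((cycleTypeClass_nonempty μ).prod Set.univ_nonempty) _

/-- The constant is `17` rather than `16` to make the inequality strict. -/
theorem eventually_lt_hrConnectedProb {α : ℝ} (hα : α < 1) :
    ∀ᶠ n : ℕ in atTop, ∀ μ : n.Partition, (Multiset.card μ.parts : ℝ) ≤ (n : ℝ) ^ α →
      1 - 1 / (n : ℝ) ^ (1 - α) - 17 * (1 / (n : ℝ) ^ (2 - α)) < hrConnectedProb μ := by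
  -- this makes `2 * n ^ α ≤ n`, so that the bound for at most `n / 2` parts applies
  have h2 : ∀ᶠ n : ℕ in atTop, 2 ≤ (n : ℝ) ^ (1 - α) :=
    ((tendsto_rpow_atTop (sub_pos.mpr hα)).comp tendsto_natCast_atTop_atTop).eventually_ge_atTop 2
  filter_upwards [h2, eventually_gt_atTop 0] with n hn2 hn μ hμ
  have hn0 : (0 : ℝ) < n := by exact_mod_cast hn
  have hpos : 0 < (n : ℝ) ^ α := Real.rpow_pos_of_pos hn0 α
  have e1 : (n : ℝ) ^ α / n = 1 / (n : ℝ) ^ (1 - α) := by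
    rw [Real.rpow_sub hn0, Real.rpow_one, one_div_div]
  have e2 : (n : ℝ) ^ α / (n : ℝ) ^ 2 = 1 / (n : ℝ) ^ (2 - α) := by
    rw [Real.rpow_sub hn0, Real.rpow_two, one_div_div]
  have hsmall : 2 * Multiset.card μ.parts ≤ n := by
    have h3 : (n : ℝ) ^ α * (n : ℝ) ^ (1 - α) = n := by
      rw [← Real.rpow_add hn0, add_sub_cancel, Real.rpow_one]
    have h4 : (2 : ℝ) * Multiset.card μ.parts ≤ n := by nlinarith
    exact_mod_cast h4
  refine lt_of_lt_of_le ?_ (one_sub_le_hrConnectedProb hn μ hsmall)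
  have h5 : (Multiset.card μ.parts : ℝ) / n ≤ (n : ℝ) ^ α / n := by gcongr
  have h6 : (Multiset.card μ.parts : ℝ) / (n : ℝ) ^ 2 ≤ (n : ℝ) ^ α / (n : ℝ) ^ 2 := by gcongr
  have h7 : 0 < (n : ℝ) ^ α / (n : ℝ) ^ 2 := by positivity
  rw [← e1, ← e2, mul_div_assoc]
  linarith

theorem tendsto_hrConnectedProb {α : ℝ} (hα : α < 1) (μ : (n : ℕ) → n.Partition)
    (hμ : ∀ᶠ n : ℕ in atTop, (Multiset.card (μ n).parts : ℝ) ≤ (n : ℝ) ^ α) :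
    Tendsto (fun n : ℕ => hrConnectedProb (μ n)) atTop (𝓝 1) := by
  have ht : ∀ s : ℝ, 0 < s → Tendsto (fun n : ℕ => 1 / (n : ℝ) ^ s) atTop (𝓝 0) := fun s hs =>
    ((tendsto_rpow_atTop hs).comp tendsto_natCast_atTop_atTop).const_div_atTop 1
  have hl : Tendsto (fun n : ℕ => 1 - 1 / (n : ℝ) ^ (1 - α) - 17 * (1 / (n : ℝ) ^ (2 - α)))
      atTop (𝓝 1) := by
    simpa using ((ht (1 - α) (by linarith)).const_sub 1).sub
      ((ht (2 - α) (by linarith)).const_mul 17)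
  refine tendsto_of_tendsto_of_tendsto_of_le_of_le' hl tendsto_const_nhds ?_
    (Eventually.of_forall fun n => hrConnectedProb_le_one (μ n))
  filter_upwards [eventually_lt_hrConnectedProb hα, hμ] with n h1 h2 using (h1 (μ n) h2).le

/-! ### The standard model -/

theorem standardConnectedProb_eq (n : ℕ) :
    standardConnectedProb n =
      1 - ((connectedPairs n)ᶜ.ncard : ℝ) / (n.factorial : ℝ) ^ 2 := by
  rw [standardConnectedProb, uniformProb_eq_one_sub Set.univ_nonempty, Set.ncard_univ,
    Nat.card_prod, Nat.card_perm, Nat.card_fin, ← Set.compl_eq_univ_sdiff]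
  push_cast
  ring_nf

theorem card_isInv_prod {n : ℕ} (A : Finset (Fin n)) :
    ((Finset.univ.filter fun p : Equiv.Perm (Fin n) × Equiv.Perm (Fin n) =>
      IsInv p.1 A ∧ IsInv p.2 A).card : ℝ) = (n.factorial : ℝ) ^ 2 / (n.choose A.card : ℝ) ^ 2 := by
  have h : (Finset.univ.filter fun p : Equiv.Perm (Fin n) × Equiv.Perm (Fin n) =>
      IsInv p.1 A ∧ IsInv p.2 A) =
      (Finset.univ.filter fun σ : Equiv.Perm (Fin n) => IsInv σ A) ×ˢ
        (Finset.univ.filter fun σ : Equiv.Perm (Fin n) => IsInv σ A) := by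
    ext p
    simp
  rw [h, Finset.card_product, Nat.cast_mul, card_isInv_eq_div_choose, Fintype.card_fin,
    ← div_pow, sq]

theorem sq_div_four_le_choose_two {n : ℕ} (hn : 2 ≤ n) : (n : ℝ) ^ 2 / 4 ≤ n.choose 2 := by
  have : (2 : ℝ) ≤ n := by exact_mod_cast hn
  rw [Nat.cast_choose_two]
  nlinarith

theorem cube_div_le_choose_three {n : ℕ} (hn : 4 ≤ n) : (n : ℝ) ^ 3 / 24 ≤ n.choose 3 := by
  have h4 : (4 : ℝ) ≤ n := by exact_mod_cast hn
  have h : (n.choose 3 : ℝ) = n * (n - 1) * (n - 2) / 6 := by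
    rw [Nat.cast_choose_eq_ascPochhammer_div]
    simp [ascPochhammer_succ_right, Nat.factorial]
    rw [Nat.cast_sub (by omega)]
    push_cast
    ring
  rw [h]
  have : (n : ℝ) ^ 2 ≤ 4 * ((n - 1) * (n - 2)) := by nlinarith
  nlinarith

theorem card_compl_connectedPairs_le {n : ℕ} (hn : 4 ≤ n) :
    ((connectedPairs n)ᶜ.ncard : ℝ) ≤ (n.factorial : ℝ) ^ 2 * (1 / n + 52 / (n : ℝ) ^ 2) := by
  classical
  have hn4 : (4 : ℝ) ≤ n := by exact_mod_cast hn
  let S : Finset (Finset (Fin n)) := Finset.univ.filter fun A => A.Nonempty ∧ 2 * A.card ≤ n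
  have hsub : (connectedPairs n)ᶜ ⊆ (S.biUnion fun A => Finset.univ.filter fun p =>
      IsInv p.1 A ∧ IsInv p.2 A : Finset (Equiv.Perm (Fin n) × Equiv.Perm (Fin n))) := by
    intro p hp
    obtain ⟨A, hne, hA, hσ, hτ⟩ :=
      SquareTiledSurface.exists_small_isInv_of_not_connectedSpace (by omega) hp
    simp only [Finset.coe_biUnion, Set.mem_iUnion, Finset.mem_coe, Finset.mem_filter, S,
      Finset.mem_univ, true_and]
    exact ⟨A, ⟨hne, hA⟩, hσ, hτ⟩
  have hle := Set.ncard_le_ncard hsub (Finset.finite_toSet _)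
  rw [Set.ncard_coe_finset] at hle
  -- the weight of a single set of size `k` in the union bound
  let f : ℕ → ℝ := fun k => if 1 ≤ k ∧ 2 * k ≤ n then 1 / (n.choose k : ℝ) ^ 2 else 0
  have hf : ∀ k ∈ Finset.range (n + 1), (n.choose k : ℝ) * f k ≤
      (if k = 1 then 1 / (n : ℝ) else 0) + (if k = 2 then 4 / (n : ℝ) ^ 2 else 0) +
        24 / (n : ℝ) ^ 3 := by
    intro k _
    by_cases hk : 1 ≤ k ∧ 2 * k ≤ n
    · have hpos : (0 : ℝ) < n.choose k := by exact_mod_cast Nat.choose_pos (by omega)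
      have hfk : (n.choose k : ℝ) * f k = 1 / n.choose k := by
        simp only [f, if_pos hk]
        field_simp
      rw [hfk]
      have h3 : 0 ≤ 24 / (n : ℝ) ^ 3 := by positivity
      rcases (show k = 1 ∨ k = 2 ∨ 3 ≤ k by omega) with rfl | rfl | hk3
      · simp
        positivity
      · have := one_div_le_one_div_of_le (by positivity) (sq_div_four_le_choose_two
          (n := n) (by omega))
        rw [one_div_div] at this
        simp only [OfNat.ofNat_ne_one, if_false, if_true]
        linarith
      · have h1 : (n.choose 3 : ℝ) ≤ n.choose k := by
          exact_mod_cast choose_le_choose_of_le_half hk3 hk.2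
        have := one_div_le_one_div_of_le (by positivity) ((cube_div_le_choose_three hn).trans h1)
        rw [one_div_div] at this
        rw [if_neg (by omega), if_neg (by omega)]
        linarith
    · simp only [f, if_neg hk, mul_zero]
      positivity
  calc ((connectedPairs n)ᶜ.ncard : ℝ)
      ≤ ∑ A ∈ S, ((Finset.univ.filter fun p : Equiv.Perm (Fin n) × Equiv.Perm (Fin n) =>
          IsInv p.1 A ∧ IsInv p.2 A).card : ℝ) := by
        exact_mod_cast hle.trans Finset.card_biUnion_le
    _ = ∑ A ∈ (Finset.univ : Finset (Fin n)).powerset, (n.factorial : ℝ) ^ 2 * f A.card := by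
        rw [Finset.sum_filter, Finset.powerset_univ]
        refine Finset.sum_congr rfl fun A _ => ?_
        rw [card_isInv_prod]
        simp only [f, Nat.succ_le_iff, Finset.card_pos, mul_ite, mul_zero, mul_one_div]
    _ = (n.factorial : ℝ) ^ 2 * ∑ k ∈ Finset.range (n + 1), (n.choose k : ℝ) * f k := by
        rw [← Finset.mul_sum, Finset.sum_powerset_apply_card, Finset.card_univ, Fintype.card_fin]
        simp only [nsmul_eq_mul]
    _ ≤ (n.factorial : ℝ) ^ 2 * (1 / n + 4 / (n : ℝ) ^ 2 + (n + 1) * (24 / (n : ℝ) ^ 3)) := by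
        refine mul_le_mul_of_nonneg_left ((Finset.sum_le_sum hf).trans_eq ?_) (by positivity)
        rw [Finset.sum_add_distrib, Finset.sum_add_distrib, Finset.sum_ite_eq',
          Finset.sum_ite_eq', if_pos (by simp; omega), if_pos (by simp; omega), Finset.sum_const,
          Finset.card_range, nsmul_eq_mul]
        push_cast
        ring
    _ ≤ (n.factorial : ℝ) ^ 2 * (1 / n + 52 / (n : ℝ) ^ 2) := by
        refine mul_le_mul_of_nonneg_left ?_ (by positivity)
        have : ((n : ℝ) + 1) * (24 / (n : ℝ) ^ 3) ≤ 48 / (n : ℝ) ^ 2 := by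
          rw [← mul_div_assoc, div_le_div_iff₀ (by positivity) (by positivity)]
          have : 0 < (n : ℝ) ^ 2 := by positivity
          nlinarith
        have e : (52 : ℝ) / (n : ℝ) ^ 2 = 4 / (n : ℝ) ^ 2 + 48 / (n : ℝ) ^ 2 := by ring
        rw [e]
        linarith

/-- Second-order lower bound: with `N` the number of common fixed points of `σ` and `τ`, the
inequality `3 N - N ^ 2 ≤ 2 * 1_{N ≠ 0}` is summed over all pairs. -/
theorem le_card_compl_connectedPairs {n : ℕ} (hn : 2 ≤ n) :
    (n.factorial : ℝ) ^ 2 * (1 / n - 8 / (n : ℝ) ^ 2) ≤ ((connectedPairs n)ᶜ.ncard : ℝ) := by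
  classical
  have hn2 : (2 : ℝ) ≤ n := by exact_mod_cast hn
  let P := Equiv.Perm (Fin n) × Equiv.Perm (Fin n)
  let a : P → Fin n → ℝ := fun p i => if p.1 i = i ∧ p.2 i = i then 1 else 0
  let d : P → ℝ := fun p => if p ∈ (connectedPairs n)ᶜ then 1 else 0
  have hd : ∑ p, d p = ((connectedPairs n)ᶜ.ncard : ℝ) := by
    simp only [d]
    rw [Finset.sum_boole, Set.ncard_eq_toFinset_card' (connectedPairs n)ᶜ]
    congr 2
    ext p
    simp
  have hsing : ∀ (σ : Equiv.Perm (Fin n)) (i : Fin n), σ i = i → IsInv σ {i} := by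
    intro σ i h j
    rw [Finset.mem_singleton, Finset.mem_singleton]
    conv_lhs => rw [← h]
    exact σ.injective.eq_iff
  have hpair : ∀ (σ : Equiv.Perm (Fin n)) (i j : Fin n), σ i = i → σ j = j → IsInv σ {i, j} := by
    intro σ i j hi hj k
    have h1 := hsing σ i hi k
    have h2 := hsing σ j hj k
    simp only [Finset.mem_singleton] at h1 h2
    simp [h1, h2]
  have hpoint : ∀ p, 3 * ∑ i, a p i - (∑ i, a p i) * ∑ j, a p j ≤ 2 * d p := by
    intro p
    have hN : ∑ i, a p i = ((Finset.univ.filter fun i => p.1 i = i ∧ p.2 i = i).card : ℝ) := by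
      simp only [a, Finset.sum_boole]
    set N := (Finset.univ.filter fun i => p.1 i = i ∧ p.2 i = i).card with hNdef
    rw [hN]
    rcases Nat.eq_zero_or_pos N with h0 | h0
    · rw [h0]
      have : 0 ≤ d p := by simp only [d]; positivity
      simpa using this
    · obtain ⟨i, hi⟩ := Finset.card_pos.mp h0
      obtain ⟨-, h1, h2⟩ := Finset.mem_filter.mp hi
      have hp : p ∈ (connectedPairs n)ᶜ := by
        refine SquareTiledSurface.not_connectedSpace_of_isInv (Finset.singleton_nonempty i)
          (fun h => ?_) (hsing p.1 i h1) (hsing p.2 i h2)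
        have := congrArg Finset.card h
        rw [Finset.card_singleton, Finset.card_univ, Fintype.card_fin] at this
        omega
      simp only [d, if_pos hp]
      have h3 : (0 : ℤ) ≤ ((N : ℤ) - 1) * ((N : ℤ) - 2) := by
        rcases (show N = 1 ∨ 2 ≤ N by omega) with h | h
        · simp [h]
        · exact mul_nonneg (by omega) (by omega)
      have h4 : (0 : ℝ) ≤ ((N : ℝ) - 1) * ((N : ℝ) - 2) := by exact_mod_cast h3
      nlinarith
  have hdiag : ∀ i, ∑ p, a p i = (n.factorial : ℝ) ^ 2 / (n : ℝ) ^ 2 := by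
    intro i
    have h := card_isInv_prod ({i} : Finset (Fin n))
    rw [Finset.card_singleton, Nat.choose_one_right] at h
    rw [← h]
    simp only [a]
    rw [Finset.sum_boole]
    congr 2
    ext p
    have : ∀ σ : Equiv.Perm (Fin n), σ i = i ↔ IsInv σ {i} := fun σ =>
      ⟨hsing σ i, fun h => Finset.mem_singleton.mp ((h i).mpr (Finset.mem_singleton_self i))⟩
    rw [Finset.mem_filter, Finset.mem_filter, this, this]
  have hoff : ∀ i j, ∑ p, a p i * a p j ≤
      (if i = j then (n.factorial : ℝ) ^ 2 / (n : ℝ) ^ 2 else 0) +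
        (n.factorial : ℝ) ^ 2 * (16 / (n : ℝ) ^ 4) := by
    intro i j
    by_cases hij : i = j
    · subst hij
      have h1 : ∀ p, a p i * a p i = a p i := fun p => by simp [a]
      simp only [h1, hdiag, if_true]
      have : 0 ≤ (n.factorial : ℝ) ^ 2 * (16 / (n : ℝ) ^ 4) := by positivity
      linarith
    · have h := card_isInv_prod ({i, j} : Finset (Fin n))
      rw [Finset.card_pair hij] at h
      rw [if_neg hij, zero_add]
      calc ∑ p, a p i * a p j ≤ ∑ p : P, if IsInv p.1 {i, j} ∧ IsInv p.2 {i, j} then 1 else 0 := by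
            refine Finset.sum_le_sum fun p _ => ?_
            by_cases h1 : (p.1 i = i ∧ p.2 i = i) ∧ (p.1 j = j ∧ p.2 j = j)
            · rw [if_pos ⟨hpair _ _ _ h1.1.1 h1.2.1, hpair _ _ _ h1.1.2 h1.2.2⟩]
              simp [a, h1]
            · have h0 : a p i * a p j = 0 := by
                rw [not_and_or] at h1
                rcases h1 with h1 | h1 <;> simp [a, h1]
              rw [h0]
              positivity
        _ = (n.factorial : ℝ) ^ 2 / (n.choose 2 : ℝ) ^ 2 := by rw [← h, Finset.sum_boole]
        _ ≤ (n.factorial : ℝ) ^ 2 / ((n : ℝ) ^ 2 / 4) ^ 2 := by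
            gcongr
            exact sq_div_four_le_choose_two hn
        _ = _ := by
            field_simp
            norm_num
  have hsum := Finset.sum_le_sum fun p (_ : p ∈ (Finset.univ : Finset P)) => hpoint p
  rw [← Finset.mul_sum, hd, Finset.sum_sub_distrib, ← Finset.mul_sum] at hsum
  have hfirst : ∑ p, ∑ i, a p i = (n.factorial : ℝ) ^ 2 * (1 / n) := by
    rw [Finset.sum_comm, Finset.sum_congr rfl fun i _ => hdiag i, Finset.sum_const,
      Finset.card_univ, Fintype.card_fin, nsmul_eq_mul]
    field_simp
  have hsecond : ∑ p, (∑ i, a p i) * ∑ j, a p j ≤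
      (n.factorial : ℝ) ^ 2 * (1 / n + 16 / (n : ℝ) ^ 2) := by
    calc ∑ p, (∑ i, a p i) * ∑ j, a p j = ∑ i, ∑ j, ∑ p, a p i * a p j := by
          simp_rw [Finset.sum_mul_sum]
          rw [Finset.sum_comm]
          exact Finset.sum_congr rfl fun i _ => Finset.sum_comm
      _ ≤ ∑ i : Fin n, ∑ j : Fin n, ((if i = j then (n.factorial : ℝ) ^ 2 / (n : ℝ) ^ 2 else 0) +
          (n.factorial : ℝ) ^ 2 * (16 / (n : ℝ) ^ 4)) :=
          Finset.sum_le_sum fun i _ => Finset.sum_le_sum fun j _ => hoff i j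
      _ = _ := by
          simp only [Finset.sum_add_distrib, Finset.sum_ite_eq, Finset.mem_univ, if_true,
            Finset.sum_const, Finset.card_univ, Fintype.card_fin, nsmul_eq_mul]
          field_simp
  rw [hfirst] at hsum
  have e : (n.factorial : ℝ) ^ 2 * (1 / n - 8 / (n : ℝ) ^ 2) =
      (3 * ((n.factorial : ℝ) ^ 2 * (1 / n)) -
        (n.factorial : ℝ) ^ 2 * (1 / n + 16 / (n : ℝ) ^ 2)) / 2 := by ring
  rw [e]
  linarith

theorem abs_standardConnectedProb_sub_le {n : ℕ} (hn : 4 ≤ n) :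
    |standardConnectedProb n - (1 - 1 / (n : ℝ))| ≤ 52 * (1 / (n : ℝ) ^ 2) := by
  have hf : (0 : ℝ) < (n.factorial : ℝ) ^ 2 := by positivity
  have h1 := card_compl_connectedPairs_le hn
  have h2 := le_card_compl_connectedPairs (n := n) (by omega)
  rw [← div_le_iff₀' hf] at h1
  rw [← le_div_iff₀' hf] at h2
  have e1 : (52 : ℝ) / (n : ℝ) ^ 2 = 52 * (1 / (n : ℝ) ^ 2) := by ring
  have e2 : (8 : ℝ) / (n : ℝ) ^ 2 = 8 * (1 / (n : ℝ) ^ 2) := by ring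
  have h3 : 0 ≤ 1 / (n : ℝ) ^ 2 := by positivity
  rw [e1] at h1
  rw [e2] at h2
  rw [standardConnectedProb_eq, abs_le]
  constructor <;> linarith

theorem standardConnectedProb_isBigO :
    (fun n : ℕ => standardConnectedProb n - (1 - 1 / (n : ℝ)))
      =O[atTop] (fun n : ℕ => 1 / (n : ℝ) ^ 2) := by
  refine IsBigO.of_bound 52 ?_
  filter_upwards [eventually_ge_atTop 4] with n hn
  rw [Real.norm_eq_abs, Real.norm_of_nonneg (by positivity : (0 : ℝ) ≤ 1 / (n : ℝ) ^ 2)]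
  exact abs_standardConnectedProb_sub_le hn

theorem tendsto_standardConnectedProb : Tendsto standardConnectedProb atTop (𝓝 1) := by
  have h1 : Tendsto (fun n : ℕ => 1 / (n : ℝ)) atTop (𝓝 0) := tendsto_one_div_atTop_nhds_zero_nat
  have h2 : Tendsto (fun n : ℕ => 1 / (n : ℝ) ^ 2) atTop (𝓝 0) := by
    simpa using h1.pow 2
  simpa using (standardConnectedProb_isBigO.trans_tendsto h2).add (h1.const_sub 1)

/-! ### Asymptotic connectedness in both models -/

theorem mainTheorem8 :
    (Tendsto standardConnectedProb atTop (𝓝 1) ∧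
      (fun n : ℕ => standardConnectedProb n - (1 - 1 / (n : ℝ)))
        =O[atTop] (fun n : ℕ => 1 / (n : ℝ) ^ 2)) ∧
    (∀ α : ℝ, 0 ≤ α → α < 1 →
      (∀ μ : (n : ℕ) → n.Partition,
        (∀ᶠ n : ℕ in atTop, (Multiset.card (μ n).parts : ℝ) ≤ (n : ℝ) ^ α) →
          Tendsto (fun n : ℕ => hrConnectedProb (μ n)) atTop (𝓝 1)) ∧
      (∃ C : ℝ, 0 < C ∧ ∃ N : ℕ, ∀ n : ℕ, N ≤ n → ∀ μ : n.Partition,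
        (Multiset.card μ.parts : ℝ) ≤ (n : ℝ) ^ α →
          hrConnectedProb μ >
            1 - 1 / (n : ℝ) ^ (1 - α) - C * (1 / (n : ℝ) ^ (2 - α)))) := by
  refine ⟨⟨tendsto_standardConnectedProb, standardConnectedProb_isBigO⟩, fun α _ hα =>
    ⟨fun μ hμ => tendsto_hrConnectedProb hα μ hμ, 17, by norm_num, ?_⟩⟩
  obtain ⟨N, hN⟩ := eventually_atTop.mp (eventually_lt_hrConnectedProb hα)
  exact ⟨N, hN⟩
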